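/- An instance of the Stable Roommates problem (SR) with $n$ agents ($n$ even) consists of a set of $n$ agents and, for each agent, a ranked list of all the other agents (its preferences). A matching is a partition of the agents into pairs; a pair $\{a,b\}$ that is not in the matching blocks it if each of $a$ and $b$ prefers the other to its own partner; a matching is stable if no pair blocks it; and an instance is solvable if it admits a stable matching. Fix a partition of the agents into batches. A deterministic procedure makes adaptive Boolean queries: each query is an arbitrary Boolean function of the preference lists of the agents of a single batch, it may depend on the responses to the earlier queries, and the procedure eventually stops with a Boolean output. A randomized procedure is a probability distribution over deterministic procedures. It decides SR solvability with error at most $\varepsilon$ if for every instance on these agents its output is correct with probability at least $1-\varepsilon$. **Theorem.** For every $\varepsilon \in [0, 1/2)$ there are constants $c > 0$ and $n_0$, depending only on $\varepsilon$, such that the following holds for every even $n \ge n_0$ and every partition of the $n$ agents into batches of at most $n/2$ agents each: for every randomized (in particular, every deterministic) procedure that decides SR solvability with error at most $\varepsilon$ by adaptive Boolean queries to the batches, there is an instance on which its expected number of queries is at least $c\,n^2$. That is, deciding SR solvability requires $\Omega(n^2)$ Boolean queries in expectation. (Queries to the preferences of individual agents are the special case of batches of size one.) -/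

import Mathlib

open scoped ENNReal NNReal

namespace StableRoommates

/-! ### Stable Roommates instances -/

/-- A preference list of agent `a`: a ranked list, most preferred agent first, in which every
other agent appears exactly once. -/
structure PrefList {V : Type} (a : V) where
  list : List V
  nodup : list.Nodup
  mem_iff : ∀ b : V, b ∈ list ↔ b ≠ a

/-- A Stable Roommates instance on the agent set `V`: a preference list for each agent. -/
abbrev Instance (V : Type) : Type := (a : V) → PrefList a

/-- In the instance `R`, agent `a` prefers `b` to `c`: `b` appears before `c` on the preference
list of `a`. -/
def Prefers {V : Type} [DecidableEq V] (R : Instance V) (a b c : V) : Prop :=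
  (R a).list.idxOf b < (R a).list.idxOf c

/-- A matching: a partition of the agents into pairs `{a, partner a}`. -/
structure Matching (V : Type) where
  partner : V → V
  partner_ne : ∀ a : V, partner a ≠ a
  partner_partner : ∀ a : V, partner (partner a) = a

/-- `{a, b}` is a blocking pair for the matching `M`: it is a pair of distinct agents that does
not belong to `M`, and each of `a`, `b` prefers the other one to their partner in `M`. -/
def IsBlockingPair {V : Type} [DecidableEq V] (R : Instance V) (M : Matching V) (a b : V) :
    Prop :=
  a ≠ b ∧ M.partner a ≠ b ∧ Prefers R a b (M.partner a) ∧ Prefers R b a (M.partner b)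

/-- A matching is stable if it has no blocking pair. -/
def IsStable {V : Type} [DecidableEq V] (R : Instance V) (M : Matching V) : Prop :=
  ∀ a b : V, ¬ IsBlockingPair R M a b

/-- An instance is solvable if it admits a stable matching. -/
def Solvable {V : Type} [DecidableEq V] (R : Instance V) : Prop :=
  ∃ M : Matching V, IsStable R M

/-! ### Adaptive Boolean queries -/

/-- A Boolean query to a batch of agents, where the batches are the parts of a partition `P` of
the agent set: an arbitrary Boolean function of the preference lists of the agents of one batch. -/
structure BatchQuery {V : Type} [Fintype V] [DecidableEq V]
    (P : Finpartition (Finset.univ : Finset V)) where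
  batch : Finset V
  batch_mem : batch ∈ P.parts
  ask : ((a : {a : V // a ∈ batch}) → PrefList a.1) → Bool

/-- The response to a query on the instance `R`. -/
def BatchQuery.answer {V : Type} [Fintype V] [DecidableEq V]
    {P : Finpartition (Finset.univ : Finset V)} (q : BatchQuery P) (R : Instance V) : Bool :=
  q.ask (fun a => R a.1)

/-- A deterministic adaptive procedure with queries to the batches of `P`: it either stops with a
Boolean output, or makes a query and goes on in a way that depends on the response. -/
inductive Procedure {V : Type} [Fintype V] [DecidableEq V]
    (P : Finpartition (Finset.univ : Finset V)) : Type
  | output (b : Bool) : Procedure P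
  | query (q : BatchQuery P) (next : Bool → Procedure P) : Procedure P

/-- The output of a deterministic procedure on the instance `R`. -/
def Procedure.run {V : Type} [Fintype V] [DecidableEq V]
    {P : Finpartition (Finset.univ : Finset V)} : Procedure P → Instance V → Bool
  | .output b, _ => b
  | .query q next, R => (next (q.answer R)).run R

/-- The number of queries that a deterministic procedure makes on the instance `R`. -/
def Procedure.numQueries {V : Type} [Fintype V] [DecidableEq V]
    {P : Finpartition (Finset.univ : Finset V)} : Procedure P → Instance V → ℕ
  | .output _, _ => 0
  | .query q next, R => (next (q.answer R)).numQueries R + 1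

/-- A randomized procedure: a probability distribution on deterministic procedures. For a finite
agent set there are only countably many deterministic procedures, so that a discrete distribution
is the general case; the point masses `PMF.pure t` are the deterministic procedures. -/
abbrev RandomizedProcedure {V : Type} [Fintype V] [DecidableEq V]
    (P : Finpartition (Finset.univ : Finset V)) : Type :=
  PMF (Procedure P)

/-- A randomized procedure decides solvability with error at most `ε` if on each instance its
output is wrong with probability at most `ε`. -/
def RandomizedProcedure.DecidesSolvability {V : Type} [Fintype V] [DecidableEq V]
    {P : Finpartition (Finset.univ : Finset V)} (𝒜 : RandomizedProcedure P) (ε : ℝ≥0) : Prop :=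
  ∀ R : Instance V, 𝒜.toOuterMeasure {t | ¬ (t.run R = true ↔ Solvable R)} ≤ ε

/-- The expected number of queries that a randomized procedure makes on the instance `R`
(possibly infinite). -/
noncomputable def RandomizedProcedure.expectedQueries {V : Type} [Fintype V] [DecidableEq V]
    {P : Finpartition (Finset.univ : Finset V)} (𝒜 : RandomizedProcedure P) (R : Instance V) :
    ℝ≥0∞ :=
  ∑' t : Procedure P, 𝒜 t * (t.numQueries R : ℝ≥0∞)

end StableRoommates

/-! The proof reduces two-party set disjointness on `k ^ 2` bits, `k = n / 8`, to solvability. Each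
row `i` and column `j` gets a four-agent gadget. Agents 1, 2, 3 prefer each other cyclically, so no
matching is stable unless agent 1 is matched to the active agent 0. Once all active agents are held
by their gadgets, the only possible obstruction is a row `i` and a column `j` that attract each
other, i.e. `x (i, j)` and `y (i, j)` both true. Hence solvable means disjoint
(`solvable_gadgetInstance_iff`).

Since no batch exceeds half of the agents, the batches can be grouped into two sides of at least `n
/ 4` agents each. With the active rows on one side and the active columns on the other, every query
depends on `x` alone or on `y` alone. A run of `q` queries thus cuts the pairs `(x, y)` into at most
`2 ^ q` rectangles.

The analytic core is `corruption_bound`: up to an error exponential in `k ^ 2`, a rectangle has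
almost as much mass under the planted-intersection distribution as under the disjoint one. Given the
set `z` that separates the supports, a rectangle of non-negligible mass can bias few coordinates
(`level_one_inequality`). At a typical coordinate the cell `(1, 1)` is therefore about as heavy as
the three disjoint cells. Summing over accepting rectangles, a procedure with few queries that
accepts disjoint pairs must also accept intersecting ones too often. -/

namespace StableRoommates

open Finset
open scoped BigOperators

set_option linter.unusedSectionVars false

/-! ### Fourier level 1 on the cube and the corruption bound for disjointness -/

section Cube

variable {ι : Type*} [Fintype ι] [DecidableEq ι]

/-- Averaging over the cube may be done by first averaging over a single coordinate. -/
lemma expect_cube_update (i : ι) (φ : (ι → Bool) → ℝ) :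
    (𝔼 z, φ z) = 𝔼 z, (φ (Function.update z i true) + φ (Function.update z i false)) / 2 := by
  have hinv : Function.Involutive (fun z : ι → Bool => Function.update z i (!(z i))) := by
    intro z; ext j; by_cases h : j = i
    · subst h; simp
    · simp [h]
  have h1 : (𝔼 z, φ z) = 𝔼 z, φ (Function.update z i (!(z i))) :=
    (Fintype.expect_equiv hinv.toPerm _ _ (fun z => rfl)).symm
  have h2 : ∀ z : ι → Bool, (φ (Function.update z i true) + φ (Function.update z i false)) / 2
      = (φ z + φ (Function.update z i (!(z i)))) / 2 := by
    intro z
    cases hz : z i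
    · have : Function.update z i false = z := by rw [← hz]; simp
      rw [this]; simp; ring
    · have : Function.update z i true = z := by rw [← hz]; simp
      rw [this]; simp
  simp_rw [h2, ← Finset.expect_div, Finset.expect_add_distrib]
  rw [← h1]; ring

/-- The sign `±1` of a bit. -/
def sgn (b : Bool) : ℝ := if b then 1 else -1

/-- The exponential moment factorises over independent signs, and `cosh t ≤ exp (t ^ 2 / 2)` in each
coordinate. -/
lemma expect_exp_sum_sgn_le (l : ι → ℝ) :
    (𝔼 x : ι → Bool, Real.exp (∑ i, l i * sgn (x i))) ≤ Real.exp ((∑ i, l i ^ 2) / 2) := by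
  have h1 : (∑ x : ι → Bool, Real.exp (∑ i, l i * sgn (x i)))
      = ∏ i, (Real.exp (l i) + Real.exp (-l i)) := by
    simp_rw [Real.exp_sum]
    have := (Finset.prod_univ_sum (fun _ : ι => (Finset.univ : Finset Bool))
      (fun i b => Real.exp (l i * sgn b)))
    rw [Fintype.piFinset_univ] at this
    rw [← this]
    refine Finset.prod_congr rfl fun i _ => ?_
    simp [sgn]
  have h2 : (∏ i, (Real.exp (l i) + Real.exp (-l i)))
      = 2 ^ Fintype.card ι * ∏ i, Real.cosh (l i) := by
    rw [← Finset.card_univ, ← Finset.prod_const, ← Finset.prod_mul_distrib]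
    refine Finset.prod_congr rfl fun i _ => ?_
    rw [Real.cosh_eq]; ring
  rw [Fintype.expect_eq_sum_div_card, h1, h2]
  have h3 : ((Fintype.card (ι → Bool) : ℕ) : ℝ) = 2 ^ Fintype.card ι := by simp
  rw [h3, mul_div_cancel_left₀ _ (by positivity), Finset.sum_div, Real.exp_sum]
  exact Finset.prod_le_prod (fun i _ => (Real.cosh_pos _).le) fun i _ => Real.cosh_le_exp_half_sq _

/-- The level-1 inequality on the cube. -/
lemma level_one_inequality (f : (ι → Bool) → ℝ) (h0 : ∀ x, 0 ≤ f x) (h1 : ∀ x, f x ≤ 1)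
    (hF : 0 < 𝔼 x, f x) :
    ∑ i, ((𝔼 x, f x * sgn (x i)) / 𝔼 x, f x) ^ 2 ≤ 2 * -Real.log (𝔼 x, f x) := by
  set F := 𝔼 x, f x with hFdef
  set l : ι → ℝ := fun i => (𝔼 x, f x * sgn (x i)) / F with hl
  set m := ∑ i, l i ^ 2 with hm
  have hY : (𝔼 x, f x * ∑ i, l i * sgn (x i)) = m * F := by
    simp_rw [Finset.mul_sum]
    rw [Finset.expect_sum_comm, hm, Finset.sum_mul]
    refine Finset.sum_congr rfl fun i _ => ?_
    have : ∀ x : ι → Bool, f x * (l i * sgn (x i)) = l i * (f x * sgn (x i)) := fun x => by ring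
    simp_rw [this, ← Finset.mul_expect]
    have : (𝔼 x, f x * sgn (x i)) = l i * F := by
      simp only [hl]; rw [div_mul_cancel₀ _ hF.ne']
    rw [this]; ring
  -- With `Y = ∑ l i * sgn (x i)`, integrate the tangent line of `exp` at `m` against `f`: the
  -- linear term vanishes because the `f`-weighted mean of `Y` is `m`. Comparison with the moment
  -- bound `exp (m / 2)` then gives the claim.
  have hlow : Real.exp m * F ≤ 𝔼 x : ι → Bool, Real.exp (∑ i, l i * sgn (x i)) := by
    calc Real.exp m * F
        = 𝔼 x, (Real.exp m * (1 - m) * f x + Real.exp m * (f x * ∑ i, l i * sgn (x i))) := by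
          rw [Finset.expect_add_distrib, ← Finset.mul_expect, ← Finset.mul_expect, hY, ← hFdef]
          ring
      _ ≤ 𝔼 x : ι → Bool, Real.exp (∑ i, l i * sgn (x i)) := by
          refine Finset.expect_le_expect fun x _ => ?_
          set Y := ∑ i, l i * sgn (x i)
          have h3 : Real.exp m * (1 + (Y - m)) ≤ Real.exp Y := by
            have : Real.exp Y = Real.exp m * Real.exp (Y - m) := by
              rw [← Real.exp_add]; congr 1; ring
            rw [this]
            have := Real.add_one_le_exp (Y - m)
            gcongr; linarith
          calc _ = f x * (Real.exp m * (1 + (Y - m))) := by ring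
            _ ≤ f x * Real.exp Y := by gcongr; exact h0 x
            _ ≤ 1 * Real.exp Y := by gcongr; exact h1 x
            _ = _ := one_mul _
  have h4 := hlow.trans (expect_exp_sum_sgn_le l)
  rw [← hm] at h4
  have h5 := Real.log_le_log (by positivity) h4
  rw [Real.log_mul (Real.exp_pos _).ne' hF.ne', Real.log_exp, Real.log_exp] at h5
  linarith

/-- The bitwise conjunction of `x` with `z`. -/
def mask (x z : ι → Bool) : ι → Bool := fun i => x i && z i

/-- The bitwise complement. -/
def compl (z : ι → Bool) : ι → Bool := fun i => !(z i)

/-- The mean of `f` over the vectors supported in `z`. -/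
noncomputable def maskMean (f : (ι → Bool) → ℝ) (z : ι → Bool) : ℝ := 𝔼 x, f (mask x z)

/-- The mean of `f` over the vectors supported in `z` off `i`, with value `b` at `i`. -/
noncomputable def maskMeanAt (f : (ι → Bool) → ℝ) (i : ι) (b : Bool) (z : ι → Bool) : ℝ :=
  𝔼 x, f (Function.update (mask x z) i b)

lemma maskMeanAt_update (f : (ι → Bool) → ℝ) (i : ι) (b c : Bool) (z : ι → Bool) :
    maskMeanAt f i b (Function.update z i c) = maskMeanAt f i b z := by
  unfold maskMeanAt
  congr 1; ext x; congr 1; ext j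
  by_cases h : j = i
  · subst h; simp
  · simp [h, mask]

lemma maskMean_of_false (f : (ι → Bool) → ℝ) (i : ι) (z : ι → Bool) (hz : z i = false) :
    maskMean f z = maskMeanAt f i false z := by
  unfold maskMean maskMeanAt
  congr 1; ext x; congr 1; ext j
  by_cases h : j = i
  · subst h; simp [mask, hz]
  · simp [h]

lemma mask_update (x z : ι → Bool) (i : ι) (b : Bool) (hz : z i = true) :
    mask (Function.update x i b) z = Function.update (mask x z) i b := by
  ext j
  by_cases h : j = i
  · subst h; simp [mask, hz]
  · simp [h, mask]

lemma maskMean_of_true (f : (ι → Bool) → ℝ) (i : ι) (z : ι → Bool) (hz : z i = true) :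
    maskMean f z = (maskMeanAt f i true z + maskMeanAt f i false z) / 2 := by
  unfold maskMean maskMeanAt
  rw [expect_cube_update i]
  simp_rw [mask_update _ _ _ _ hz, ← Finset.expect_div, Finset.expect_add_distrib]

lemma expect_mask_sgn (f : (ι → Bool) → ℝ) (i : ι) (z : ι → Bool) (hz : z i = true) :
    (𝔼 x, f (mask x z) * sgn (x i)) = (maskMeanAt f i true z - maskMeanAt f i false z) / 2 := by
  unfold maskMeanAt
  rw [expect_cube_update i]
  simp_rw [mask_update _ _ _ _ hz, ← Finset.expect_div, Finset.expect_add_distrib,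
    Function.update_self]
  simp [sgn, Finset.expect_neg_distrib, sub_eq_add_neg]

lemma maskMeanAt_nonneg {f : (ι → Bool) → ℝ} (h0 : ∀ x, 0 ≤ f x) (i : ι) (b : Bool)
    (z : ι → Bool) : 0 ≤ maskMeanAt f i b z :=
  Finset.expect_nonneg fun _ _ => h0 _

lemma maskMean_nonneg {f : (ι → Bool) → ℝ} (h0 : ∀ x, 0 ≤ f x) (z : ι → Bool) :
    0 ≤ maskMean f z :=
  Finset.expect_nonneg fun _ _ => h0 _

lemma maskMean_le_one {f : (ι → Bool) → ℝ} (h1 : ∀ x, f x ≤ 1) (z : ι → Bool) :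
    maskMean f z ≤ 1 :=
  (Finset.expect_le_expect (fun _ _ => h1 _)).trans (by simp)

/-- The deviation of the two restrictions of `f` to a free coordinate. -/
noncomputable def dev (u v : ℝ) : ℝ := (u - v) ^ 2 / (u + v)

/-- The level-1 inequality for the restriction of `f` to the subcube given by `z`. -/
lemma sum_dev_le {f : (ι → Bool) → ℝ} (h0 : ∀ x, 0 ≤ f x) (h1 : ∀ x, f x ≤ 1) (z : ι → Bool) :
    ∑ i, (if z i then dev (maskMeanAt f i true z) (maskMeanAt f i false z) / 2 else 0)
      ≤ 2 * Real.negMulLog (maskMean f z) := by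
  rcases (maskMean_nonneg h0 z).eq_or_lt with h | hF
  -- If the mean is zero, both restrictions at a free coordinate sum to zero, and `dev` is `0` by
  -- the convention for division by zero.
  · rw [← h]
    simp only [Real.negMulLog_zero, mul_zero]
    refine Finset.sum_nonpos fun i _ => ?_
    split_ifs with hz
    · have := maskMean_of_true f i z hz
      have : maskMeanAt f i true z + maskMeanAt f i false z = 0 := by linarith
      simp [dev, this]
    · rfl
  -- Multiplied by the mean, the squared bias of a free coordinate is exactly `dev / 2`; coordinates
  -- outside `z` contribute nonnegative terms that may be dropped.
  · have hl := level_one_inequality (fun x => f (mask x z)) (fun _ => h0 _) (fun _ => h1 _) hF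
    change ∑ i, ((𝔼 x, f (mask x z) * sgn (x i)) / maskMean f z) ^ 2
      ≤ 2 * -Real.log (maskMean f z) at hl
    calc _ ≤ ∑ i, maskMean f z * ((𝔼 x, f (mask x z) * sgn (x i)) / maskMean f z) ^ 2 := by
          refine Finset.sum_le_sum fun i _ => ?_
          split_ifs with hz
          · rw [expect_mask_sgn f i z hz]
            have h2 := maskMean_of_true f i z hz
            have h3 : maskMeanAt f i true z + maskMeanAt f i false z = 2 * maskMean f z := by
              linarith
            rw [dev, h3]
            apply le_of_eq
            field_simp
          · positivity
      _ = maskMean f z * ∑ i, ((𝔼 x, f (mask x z) * sgn (x i)) / maskMean f z) ^ 2 := by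
          rw [Finset.mul_sum]
      _ ≤ maskMean f z * (2 * -Real.log (maskMean f z)) := by gcongr
      _ = _ := by rw [Real.negMulLog]; ring

/-- This moves the weight coming from the other side of the rectangle inside `negMulLog`, where
Jensen applies to the product. -/
lemma negMulLog_mul_le {a b : ℝ} (ha : 0 ≤ a) (hb : 0 ≤ b) (hb1 : b ≤ 1) :
    Real.negMulLog a * b ≤ Real.negMulLog (a * b) := by
  rw [Real.negMulLog_mul]
  have := Real.negMulLog_nonneg hb hb1
  nlinarith [mul_nonneg ha this]

lemma expect_negMulLog_le (w : (ι → Bool) → ℝ) (hw : ∀ z, 0 ≤ w z) :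
    (𝔼 z, Real.negMulLog (w z)) ≤ Real.negMulLog (𝔼 z, w z) := by
  have h := Real.concaveOn_negMulLog.le_map_sum (t := Finset.univ)
    (w := fun _ : ι → Bool => ((Fintype.card (ι → Bool) : ℝ))⁻¹) (p := w)
    (fun _ _ => by positivity) (by simp) (fun z _ => hw z)
  simp only [smul_eq_mul, ← Finset.mul_sum] at h
  rw [Fintype.expect_eq_sum_div_card, Fintype.expect_eq_sum_div_card, div_eq_inv_mul,
    div_eq_inv_mul]
  exact h

/-- The mean of `h` on the distribution of disjoint pairs. -/
noncomputable def disjMean (h : (ι → Bool) → (ι → Bool) → ℝ) : ℝ :=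
  𝔼 z, 𝔼 x, 𝔼 y, h (mask x z) (mask y (compl z))

/-- The mean of `h` on the distribution of pairs that meet in one planted coordinate. -/
noncomputable def meetMean (h : (ι → Bool) → (ι → Bool) → ℝ) : ℝ :=
  𝔼 i, 𝔼 z, 𝔼 x, 𝔼 y,
    h (Function.update (mask x z) i true) (Function.update (mask y (compl z)) i true)

lemma disjMean_mul (f g : (ι → Bool) → ℝ) :
    disjMean (fun x y => f x * g y) = 𝔼 z, maskMean f z * maskMean g (compl z) := by
  unfold disjMean maskMean
  refine Finset.expect_congr rfl fun z _ => ?_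
  rw [Finset.expect_mul_expect]

lemma meetMean_mul (f g : (ι → Bool) → ℝ) :
    meetMean (fun x y => f x * g y)
      = 𝔼 i, 𝔼 z, maskMeanAt f i true z * maskMeanAt g i true (compl z) := by
  unfold meetMean maskMeanAt
  refine Finset.expect_congr rfl fun i _ => Finset.expect_congr rfl fun z _ => ?_
  rw [Finset.expect_mul_expect]

lemma compl_update (z : ι → Bool) (i : ι) (b : Bool) :
    compl (Function.update z i b) = Function.update (compl z) i (!b) := by
  ext j
  by_cases h : j = i
  · subst h; simp [compl]
  · simp [h, compl]

lemma compl_compl (z : ι → Bool) : compl (compl z) = z := by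
  ext j; simp [compl]

/-- The equivalence of the cube with itself by complement. -/
def complEquiv : (ι → Bool) ≃ (ι → Bool) where
  toFun := compl
  invFun := compl
  left_inv := compl_compl
  right_inv := compl_compl

/-- Conditioning on `z i` exposes the three disjoint cells at coordinate `i`: `(0, 0)` with weight
1/2, `(1, 0)` and `(0, 1)` with weight 1/4 each. -/
lemma disjMean_mul_eq (f g : (ι → Bool) → ℝ) (i : ι) :
    disjMean (fun x y => f x * g y) = 𝔼 z,
      ((maskMeanAt f i true z + maskMeanAt f i false z) * maskMeanAt g i false (compl z)
        + maskMeanAt f i false z *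
          (maskMeanAt g i true (compl z) + maskMeanAt g i false (compl z))) / 4 := by
  rw [disjMean_mul, expect_cube_update i]
  refine Finset.expect_congr rfl fun z _ => ?_
  rw [compl_update, compl_update]
  rw [maskMean_of_true f i (Function.update z i true) (by simp),
    maskMean_of_false f i (Function.update z i false) (by simp),
    maskMean_of_false g i (Function.update (compl z) i (!true)) (by simp),
    maskMean_of_true g i (Function.update (compl z) i (!false)) (by simp)]
  simp only [maskMeanAt_update]
  ring

/-- The level-1 bound is applied to `f` for each fixed `z`, weighted by the mean of `g`, and
averaged over `z` by concavity of `negMulLog`. -/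
lemma sum_expect_dev_le {f g : (ι → Bool) → ℝ} (hf0 : ∀ x, 0 ≤ f x) (hf1 : ∀ x, f x ≤ 1)
    (hg0 : ∀ x, 0 ≤ g x) (hg1 : ∀ x, g x ≤ 1) :
    ∑ i, 𝔼 z, dev (maskMeanAt f i true z) (maskMeanAt f i false z) * maskMeanAt g i false (compl z)
      ≤ 8 * Real.negMulLog (𝔼 z, maskMean f z * maskMean g (compl z)) := by
  -- The integrand on the left does not depend on `z i`, so it may be evaluated on `z i = true`,
  -- where `g` is forced to be false at `i`. The factor 4 undoes the probability 1/2 of this event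
  -- and the halving of `dev`.
  have key : ∀ i : ι, (𝔼 z, dev (maskMeanAt f i true z) (maskMeanAt f i false z)
        * maskMeanAt g i false (compl z))
      = 4 * 𝔼 z, (if z i then dev (maskMeanAt f i true z) (maskMeanAt f i false z) / 2 else 0)
        * maskMean g (compl z) := by
    intro i
    rw [expect_cube_update i (fun z => (if z i then _ else _) * _), Finset.mul_expect]
    refine Finset.expect_congr rfl fun z _ => ?_
    simp only [Function.update_self, if_true, maskMeanAt_update, compl_update]
    rw [maskMean_of_false g i (Function.update (compl z) i (!true)) (by simp)]
    simp only [maskMeanAt_update]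
    simp
    ring
  simp_rw [key, ← Finset.mul_sum, ← Finset.expect_sum_comm, ← Finset.sum_mul]
  have : (𝔼 z, (∑ i, (if z i then dev (maskMeanAt f i true z) (maskMeanAt f i false z) / 2 else 0))
        * maskMean g (compl z))
      ≤ 𝔼 z, 2 * Real.negMulLog (maskMean f z * maskMean g (compl z)) := by
    refine Finset.expect_le_expect fun z _ => ?_
    have h1 := sum_dev_le hf0 hf1 z
    have h2 := negMulLog_mul_le (maskMean_nonneg hf0 z) (maskMean_nonneg hg0 (compl z))
      (maskMean_le_one hg1 (compl z))
    have h3 := mul_le_mul_of_nonneg_right h1 (maskMean_nonneg hg0 (compl z))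
    linarith
  rw [← Finset.mul_expect] at this
  have h4 := expect_negMulLog_le (fun z => maskMean f z * maskMean g (compl z))
    (fun z => mul_nonneg (maskMean_nonneg hf0 z) (maskMean_nonneg hg0 _))
  linarith

lemma sum_expect_dev_le' {f g : (ι → Bool) → ℝ} (hf0 : ∀ x, 0 ≤ f x) (hf1 : ∀ x, f x ≤ 1)
    (hg0 : ∀ x, 0 ≤ g x) (hg1 : ∀ x, g x ≤ 1) :
    ∑ i, 𝔼 z, maskMeanAt f i false z *
        dev (maskMeanAt g i true (compl z)) (maskMeanAt g i false (compl z))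
      ≤ 8 * Real.negMulLog (𝔼 z, maskMean f z * maskMean g (compl z)) := by
  have h := sum_expect_dev_le hg0 hg1 hf0 hf1
  have e1 : (𝔼 z, maskMean g z * maskMean f (compl z))
      = 𝔼 z, maskMean f z * maskMean g (compl z) :=
    Fintype.expect_equiv complEquiv _ _ fun z => by
      change _ = maskMean f (compl z) * maskMean g (compl (compl z))
      rw [compl_compl, mul_comm]
  rw [e1] at h
  refine le_trans (le_of_eq ?_) h
  refine Finset.sum_congr rfl fun i _ => ?_
  exact (Fintype.expect_equiv complEquiv _ _ fun z => by
      change _ = maskMeanAt f i false (compl z) *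
        dev (maskMeanAt g i true (compl (compl z))) (maskMeanAt g i false (compl (compl z)))
      rw [compl_compl, mul_comm]).symm

end Cube

lemma dev_nonneg {u v : ℝ} (hu : 0 ≤ u) (hv : 0 ≤ v) : 0 ≤ dev u v := by
  unfold dev; positivity

lemma dev_mul (s u : ℝ) : dev (s * u) u = u * dev s 1 := by
  unfold dev
  rcases eq_or_ne u 0 with rfl | hu
  · simp
  rcases eq_or_ne (s + 1) 0 with h | h
  · have : s * u + u = 0 := by linear_combination u * h
    simp [this, h]
  · have : s * u + u = (s + 1) * u := by ring
    rw [this]; field_simp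

/-- Once `s` is at distance more than `κ` from 1, `|s - 1|` controls `κ * (s + 1)` up to a factor 3,
both for small and for large `s`. -/
lemma le_dev_one {κ s : ℝ} (hκ : 0 < κ) (hκ1 : κ ≤ 1) (hs : 0 ≤ s) (h : κ < |s - 1|) :
    κ ^ 2 / 9 * (1 + s) ≤ dev s 1 := by
  unfold dev
  rw [le_div_iff₀ (by linarith)]
  have h1 : κ * (s + 1) ≤ 3 * |s - 1| := by
    rcases le_total s 1 with h2 | h2
    · rw [abs_of_nonpos (by linarith)] at h ⊢
      nlinarith
    · rw [abs_of_nonneg (by linarith)] at h ⊢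
      nlinarith
  have h2 : (κ * (s + 1)) ^ 2 ≤ (3 * |s - 1|) ^ 2 := by
    apply pow_le_pow_left₀ (by positivity) h1
  rw [mul_pow 3, sq_abs] at h2
  nlinarith

lemma sub_three_le_dev_one {t : ℝ} (ht : 0 ≤ t) : t - 3 ≤ dev t 1 := by
  unfold dev
  rw [le_div_iff₀ (by linarith)]
  nlinarith

/-- If one ratio is far from 1, the deviations pay for the whole disjoint mass. A large `t` is paid
for by `dev t 1 ≥ t - 3`, and 45 is 5 times the 9 of `le_dev_one`, since `5 * (1 + s) + (t - 3)`
dominates `2 + s + t`. -/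
lemma planted_cell_ge_aux {κ : ℝ} (hκ : 0 < κ) (hκ1 : κ ≤ 1) {s t : ℝ} (hs : 0 ≤ s) (ht : 0 ≤ t)
    (h : κ < |s - 1|) : (2 + s + t) / 4 ≤ 45 / κ ^ 2 * (dev s 1 + dev t 1) := by
  have h1 := le_dev_one hκ hκ1 hs h
  have h2 := sub_three_le_dev_one ht
  have h3 := dev_nonneg ht zero_le_one
  have h4 : 1 ≤ 45 / κ ^ 2 := by
    rw [le_div_iff₀ (by positivity)]; nlinarith
  have h5 : 5 * (1 + s) ≤ 45 / κ ^ 2 * dev s 1 := by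
    calc 5 * (1 + s) = 45 / κ ^ 2 * (κ ^ 2 / 9 * (1 + s)) := by field_simp; norm_num
      _ ≤ _ := by gcongr
  nlinarith

/-- A pointwise comparison of the planted cell with the other three cells. -/
lemma planted_cell_ge {η : ℝ} (hη : 0 < η) (hη1 : η ≤ 1) : ∃ K : ℝ, 0 < K ∧ ∀ u u' v v' : ℝ,
    0 ≤ u → 0 ≤ u' → 0 ≤ v → 0 ≤ v' →
    (1 - η) * (((u' + u) * v + u * (v' + v)) / 4) - K * (dev u' u * v + u * dev v' v)
      ≤ u' * v' := by
  refine ⟨45 / (η / 4) ^ 2, by positivity, ?_⟩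
  set κ := η / 4 with hκdef
  have hκ : 0 < κ := by positivity
  have hκ1 : κ ≤ 1 := by linarith
  have hK : 1 ≤ 45 / κ ^ 2 := by
    rw [le_div_iff₀ (by positivity)]; nlinarith
  have hst : ∀ s t : ℝ, 0 ≤ s → 0 ≤ t →
      (1 - η) * ((2 + s + t) / 4) - 45 / κ ^ 2 * (dev s 1 + dev t 1) ≤ s * t := by
    intro s t hs ht
    have d1 := dev_nonneg hs zero_le_one
    have d2 := dev_nonneg ht zero_le_one
    have hst0 : 0 ≤ s * t := mul_nonneg hs ht
    have hA : (1 - η) * ((2 + s + t) / 4) ≤ (2 + s + t) / 4 := by nlinarith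
    by_cases h1 : κ < |s - 1|
    · have := planted_cell_ge_aux hκ hκ1 hs ht h1
      linarith
    by_cases h2 : κ < |t - 1|
    · have := planted_cell_ge_aux hκ hκ1 ht hs h2
      rw [add_comm (dev t 1)] at this
      linarith
    -- Both ratios are within `κ = η / 4` of 1: the product is at least `(1 - κ) ^ 2`, while the
    -- disjoint average is at most `1 + κ / 2`, and the factor `1 - η` absorbs the gap.
    rw [not_lt, abs_le] at h1 h2
    have h3 : (1 - κ) * (1 - κ) ≤ s * t := by
      apply mul_le_mul <;> linarith
    have h4 : 0 ≤ 45 / κ ^ 2 * (dev s 1 + dev t 1) := by positivity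
    nlinarith
  intro u u' v v' hu hu' hv hv'
  have huv' : 0 ≤ u' * v' := by positivity
  -- For a vanishing denominator `dev u' 0 = u'`, and `K ≥ 1` makes the deviation term exceed the
  -- main term.
  rcases hu.eq_or_lt with rfl | hu
  · have : dev u' 0 = u' := by
      unfold dev
      rcases eq_or_ne u' 0 with rfl | h
      · simp
      · simp; field_simp
    rw [this]
    have := mul_nonneg hu' hv
    nlinarith
  rcases hv.eq_or_lt with rfl | hv
  · have : dev v' 0 = v' := by
      unfold dev
      rcases eq_or_ne v' 0 with rfl | h
      · simp
      · simp; field_simp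
    rw [this]
    have := mul_nonneg hu.le hv'
    nlinarith
  -- The inequality is homogeneous in `(u, u')` and in `(v, v')`, so it reduces to the ratios.
  have h := hst (u' / u) (v' / v) (by positivity) (by positivity)
  have e1 : dev u' u = u * dev (u' / u) 1 := by rw [← dev_mul, div_mul_cancel₀ _ hu.ne']
  have e2 : dev v' v = v * dev (v' / v) 1 := by rw [← dev_mul, div_mul_cancel₀ _ hv.ne']
  have h' := mul_le_mul_of_nonneg_left h (mul_pos hu hv).le
  rw [e1, e2]
  refine le_trans (le_of_eq ?_) (h'.trans (le_of_eq ?_))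
  · have a1 : u' = u * (u' / u) := by field_simp
    have a2 : v' = v * (v' / v) := by field_simp
    generalize u' / u = s at *
    generalize v' / v = t at *
    subst a1 a2
    ring
  · field_simp

/-- The corruption bound for disjointness: a rectangle that carries a substantial share of the
disjoint pairs carries almost the same share of the pairs that meet in a planted coordinate. -/
theorem corruption_bound {γ : ℝ} (hγ : 0 < γ) (hγ1 : γ ≤ 1) : ∃ δ : ℝ, 0 < δ ∧ δ ≤ 1 ∧
    ∀ (ι : Type) [Fintype ι] [DecidableEq ι] [Nonempty ι] (f g : (ι → Bool) → ℝ),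
      (∀ x, 0 ≤ f x) → (∀ x, f x ≤ 1) → (∀ x, 0 ≤ g x) → (∀ x, g x ≤ 1) →
      (1 - γ) * disjMean (fun x y => f x * g y) - Real.exp (-(δ * Fintype.card ι))
        ≤ meetMean (fun x y => f x * g y) := by
  obtain ⟨K, hK, hpt⟩ := planted_cell_ge (half_pos hγ) (by linarith)
  -- Half of `γ` is spent in the pointwise comparison and half on deviations. The latter cost at
  -- most `16 * K * δ * N * W` over all coordinates, whence 32.
  refine ⟨min 1 (γ / (32 * K)), by positivity, min_le_left _ _, ?_⟩
  intro ι _ _ _ f g hf0 hf1 hg0 hg1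
  set δ := min 1 (γ / (32 * K)) with hδ
  set N : ℝ := ((Fintype.card ι : ℕ) : ℝ) with hN
  have hNpos : 0 < N := by rw [hN]; exact_mod_cast Fintype.card_pos
  have hmeet0 : 0 ≤ meetMean (fun x y => f x * g y) := by
    rw [meetMean_mul]
    exact Finset.expect_nonneg fun i _ => Finset.expect_nonneg fun z _ =>
      mul_nonneg (maskMeanAt_nonneg hf0 _ _ _) (maskMeanAt_nonneg hg0 _ _ _)
  set W := disjMean (fun x y => f x * g y) with hW
  have hWe : W = 𝔼 z, maskMean f z * maskMean g (compl z) := disjMean_mul f g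
  rcases lt_or_ge W (Real.exp (-(δ * N))) with hlt | hge
  -- A rectangle lighter than the error term satisfies the bound trivially, since the left side is
  -- nonpositive.
  · have hW0 : 0 ≤ W := by
      rw [hWe]
      exact Finset.expect_nonneg fun z _ =>
        mul_nonneg (maskMean_nonneg hf0 _) (maskMean_nonneg hg0 _)
    nlinarith
  have hWpos : 0 < W := (Real.exp_pos _).trans_le hge
  have hlog : -Real.log W ≤ δ * N := by
    have := Real.log_le_log (Real.exp_pos _) hge
    rw [Real.log_exp] at this
    linarith
  have hnml : Real.negMulLog W ≤ W * (δ * N) := by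
    rw [Real.negMulLog]
    nlinarith
  have hA := sum_expect_dev_le hf0 hf1 hg0 hg1
  have hB := sum_expect_dev_le' hf0 hf1 hg0 hg1
  rw [← hWe] at hA hB
  have hi : ∀ i : ι, (1 - γ / 2) * W
      - K * ((𝔼 z, dev (maskMeanAt f i true z) (maskMeanAt f i false z)
          * maskMeanAt g i false (compl z))
        + 𝔼 z, maskMeanAt f i false z *
          dev (maskMeanAt g i true (compl z)) (maskMeanAt g i false (compl z)))
      ≤ 𝔼 z, maskMeanAt f i true z * maskMeanAt g i true (compl z) := by
    intro i
    rw [hW, disjMean_mul_eq f g i, Finset.mul_expect, ← Finset.expect_add_distrib,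
      Finset.mul_expect, ← Finset.expect_sub_distrib]
    exact Finset.expect_le_expect fun z _ => hpt _ _ _ _ (maskMeanAt_nonneg hf0 _ _ _)
      (maskMeanAt_nonneg hf0 _ _ _) (maskMeanAt_nonneg hg0 _ _ _) (maskMeanAt_nonneg hg0 _ _ _)
  have hsum := Finset.sum_le_sum fun i (_ : i ∈ Finset.univ) => hi i
  rw [Finset.sum_sub_distrib, Finset.sum_const, Finset.card_univ, nsmul_eq_mul, ← hN,
    ← Finset.mul_sum, Finset.sum_add_distrib] at hsum
  rw [meetMean_mul, Fintype.expect_eq_sum_div_card, ← hN, le_div_iff₀ hNpos]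
  refine le_trans ?_ hsum
  have hKd : K * (16 * (W * (δ * N))) ≤ γ / 2 * W * N := by
    have h1 : δ * (32 * K) ≤ γ := (le_div_iff₀ (by positivity)).1 (min_le_right _ _)
    have h2 : 0 ≤ W * N := by positivity
    nlinarith
  have hexp := mul_pos (Real.exp_pos (-(δ * N))) hNpos
  have hAB := mul_le_mul_of_nonneg_left (add_le_add hA hB) hK.le
  have hK16 : K * (8 * W.negMulLog + 8 * W.negMulLog) ≤ K * (16 * (W * (δ * N))) := by
    gcongr; linarith
  linarith

end StableRoommates

namespace StableRoommates

/-! ### The four-agent gadgets and their stable matchings -/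

section Gadget

variable {k m : ℕ}

/-- The roles of the agents in the reduction: a gadget of four agents for each row and each
column, whose agents number `0` are the active ones, and pairs of dummies. -/
abbrev Role (k m : ℕ) : Type := (Fin k ⊕ Fin k) × Fin 4 ⊕ Fin m × Bool

/-- Whether an active agent finds another active agent attractive. -/
def attracted (x y : Fin k × Fin k → Bool) : Fin k ⊕ Fin k → Fin k ⊕ Fin k → Bool
  | .inl i, .inr j => x (i, j)
  | .inr j, .inl i => y (i, j)
  | _, _ => false

/-- The rank that an agent gives to another one; smaller is better. -/
def rank (x y : Fin k × Fin k → Bool) : Role k m → Role k m → ℕ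
  | .inl (g, 0), .inl (g', 0) => if attracted x y g g' then 0 else 2
  | .inl (g, 0), .inl (g', 1) => if g = g' then 1 else 2
  | .inl (g, 1), .inl (g', 0) => if g = g' then 0 else 3
  | .inl (g, 1), .inl (g', 2) => if g = g' then 1 else 3
  | .inl (g, 1), .inl (g', 3) => if g = g' then 2 else 3
  | .inl (g, 2), .inl (g', 3) => if g = g' then 0 else 3
  | .inl (g, 2), .inl (g', 1) => if g = g' then 1 else 3
  | .inl (g, 3), .inl (g', 1) => if g = g' then 0 else 3
  | .inl (g, 3), .inl (g', 2) => if g = g' then 1 else 3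
  | .inr (d, b), .inr (d', b') => if d = d' ∧ b' = !b then 0 else 3
  | _, _ => 3

/-- The canonical partner of an agent. -/
def mate : Role k m → Role k m
  | .inl (g, 0) => .inl (g, 1)
  | .inl (g, 1) => .inl (g, 0)
  | .inl (g, 2) => .inl (g, 3)
  | .inl (g, 3) => .inl (g, 2)
  | .inr (d, b) => .inr (d, !b)

lemma mate_mate (s : Role k m) : mate (mate s) = s := by
  rcases s with ⟨g, c⟩ | ⟨d, b⟩
  · fin_cases c <;> rfl
  · simp [mate]

lemma mate_ne (s : Role k m) : mate s ≠ s := by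
  rcases s with ⟨g, c⟩ | ⟨d, b⟩
  · fin_cases c <;> simp [mate]
  · simp [mate]

/-- The agents that rank an agent at least as high as their mate. -/
lemma eq_of_rank_le (x y : Fin k × Fin k → Bool) (s t : Role k m) (hm : mate s ≠ t)
    (h : rank x y s t ≤ rank x y s (mate s)) :
    (∃ g g', s = .inl (g, 0) ∧ t = .inl (g', 0) ∧ attracted x y g g' = true) ∨
      ∃ g, s = .inl (g, 3) ∧ t = .inl (g, 1) := by
  rcases s with ⟨g, c⟩ | ⟨d, b⟩ <;> rcases t with ⟨g', c'⟩ | ⟨d', b'⟩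
  · fin_cases c <;> fin_cases c' <;> simp [rank, mate] at h hm ⊢ <;>
      first | assumption | (exact h.symm) | (exact hm h) | (split_ifs at h <;> simp_all)
  · fin_cases c <;> simp [rank, mate] at h
  · simp [rank, mate] at h
  · simp [rank, mate] at h hm ⊢
    cases b <;> cases b' <;> simp_all

/-- The canonical matching has no blocking pair if the two vectors are disjoint. -/
lemma mate_not_blocked (x y : Fin k × Fin k → Bool) (hxy : ∀ p, ¬ (x p = true ∧ y p = true))
    (s t : Role k m) (hm : mate s ≠ t)
    (h1 : rank x y s t ≤ rank x y s (mate s)) (h2 : rank x y t s ≤ rank x y t (mate t)) :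
    False := by
  have hm' : mate t ≠ s := fun h => hm (by rw [← h, mate_mate])
  rcases eq_of_rank_le x y s t hm h1 with ⟨g, g', rfl, rfl, h3⟩ | ⟨g, rfl, rfl⟩
  · rcases eq_of_rank_le x y _ _ hm' h2 with ⟨a, a', e1, e2, h4⟩ | ⟨a, e1, e2⟩
    · simp at e1 e2
      subst e1 e2
      rcases g with i | i <;> rcases g' with j | j <;> simp [attracted] at h3 h4
      · exact hxy _ ⟨h3, h4⟩
      · exact hxy _ ⟨h4, h3⟩
    · simp at e1
  · rcases eq_of_rank_le x y _ _ hm' h2 with ⟨a, a', e1, e2, h4⟩ | ⟨a, e1, e2⟩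
    · simp at e1
    · simp at e1

/-- In a matching without blocking pairs each active agent has its canonical partner. -/
lemma partner_active (x y : Fin k × Fin k → Bool) (q : Role k m → Role k m)
    (hq : ∀ s, q (q s) = s) (hne : ∀ s, q s ≠ s)
    (hst : ∀ s t, s ≠ t → rank x y s t < rank x y s (q s) → ¬ rank x y t s < rank x y t (q t))
    (g : Fin k ⊕ Fin k) : q (.inl (g, 1)) = .inl (g, 0) := by
  by_contra h10
  have r1 : ∀ t : Role k m, t ≠ .inl (g, 0) → t ≠ .inl (g, 1) → t ≠ .inl (g, 2) →
      t ≠ .inl (g, 3) → rank x y (.inl (g, 1)) t = 3 := by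
    rintro (⟨g', c⟩ | ⟨d, b⟩) h0 h1 h2 h3
    · fin_cases c <;> simp [rank] at h0 h1 h2 h3 ⊢ <;> tauto
    · rfl
  have r2 : ∀ t : Role k m, t ≠ .inl (g, 1) → t ≠ .inl (g, 3) →
      rank x y (.inl (g, 2)) t = 3 := by
    rintro (⟨g', c⟩ | ⟨d, b⟩) h0 h1
    · fin_cases c <;> simp [rank] at h0 h1 ⊢ <;> tauto
    · rfl
  have r3 : ∀ t : Role k m, t ≠ .inl (g, 1) → t ≠ .inl (g, 2) →
      rank x y (.inl (g, 3)) t = 3 := by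
    rintro (⟨g', c⟩ | ⟨d, b⟩) h0 h1
    · fin_cases c <;> simp [rank] at h0 h1 ⊢ <;> tauto
    · rfl
  have e12 : rank x y (.inl (g, 1) : Role k m) (.inl (g, 2)) = 1 := by simp [rank]
  have e13 : rank x y (.inl (g, 1) : Role k m) (.inl (g, 3)) = 2 := by simp [rank]
  have e21 : rank x y (.inl (g, 2) : Role k m) (.inl (g, 1)) = 1 := by simp [rank]
  have e23 : rank x y (.inl (g, 2) : Role k m) (.inl (g, 3)) = 0 := by simp [rank]
  have e31 : rank x y (.inl (g, 3) : Role k m) (.inl (g, 1)) = 0 := by simp [rank]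
  have e32 : rank x y (.inl (g, 3) : Role k m) (.inl (g, 2)) = 1 := by simp [rank]
  -- Without agent 0, the preferences of 1, 2, 3 are cyclic: 1 prefers 2 to 3, 2 prefers 3 to 1, 3
  -- prefers 1 to 2, and all prefer these to outsiders. Each of the three pairs must fail to block,
  -- and the three resulting alternatives are incompatible.
  have b12 : q (.inl (g, 1)) = .inl (g, 2) ∨ q (.inl (g, 2)) = .inl (g, 3) := by
    by_contra! hc
    have h21 : q (.inl (g, 2)) ≠ .inl (g, 1) := fun h => hc.1 (by rw [← h, hq])
    refine hst (.inl (g, 1)) (.inl (g, 2)) (by simp) ?_ ?_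
    · rw [e12]
      by_cases h13 : q (.inl (g, 1)) = .inl (g, 3)
      · rw [h13, e13]; norm_num
      · rw [r1 _ h10 (hne _) hc.1 h13]; norm_num
    · rw [e21, r2 _ h21 hc.2]; norm_num
  have b13 : q (.inl (g, 1)) = .inl (g, 2) ∨ q (.inl (g, 1)) = .inl (g, 3) := by
    by_contra! hc
    have h31 : q (.inl (g, 3)) ≠ .inl (g, 1) := fun h => hc.2 (by rw [← h, hq])
    refine hst (.inl (g, 1)) (.inl (g, 3)) (by simp) ?_ ?_
    · rw [e13, r1 _ h10 (hne _) hc.1 hc.2]; norm_num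
    · rw [e31]
      by_cases h32 : q (.inl (g, 3)) = .inl (g, 2)
      · rw [h32, e32]; norm_num
      · rw [r3 _ h31 h32]; norm_num
  have b23 : q (.inl (g, 2)) = .inl (g, 3) ∨ q (.inl (g, 3)) = .inl (g, 1) := by
    by_contra! hc
    have h32 : q (.inl (g, 3)) ≠ .inl (g, 2) := fun h => hc.1 (by rw [← h, hq])
    refine hst (.inl (g, 2)) (.inl (g, 3)) (by simp) ?_ ?_
    · rw [e23]
      by_cases h21 : q (.inl (g, 2)) = .inl (g, 1)
      · rw [h21, e21]; norm_num
      · rw [r2 _ h21 hc.1]; norm_num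
    · rw [e32, r3 _ hc.2 h32]; norm_num
  rcases b13 with h | h
  · have h21 : q (.inl (g, 2)) = .inl (g, 1) := by rw [← h, hq]
    rcases b23 with h' | h'
    · rw [h21] at h'; simp at h'
    · have : q (.inl (g, 1)) = .inl (g, 3) := by rw [← h', hq]
      rw [h] at this; simp at this
  · have h31 : q (.inl (g, 3)) = .inl (g, 1) := by rw [← h, hq]
    rcases b12 with h' | h'
    · rw [h] at h'; simp at h'
    · have : q (.inl (g, 3)) = .inl (g, 2) := by rw [← h', hq]
      rw [h31] at this; simp at this

/-- If the two vectors meet, then every matching has a blocking pair. -/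
lemma exists_blocked (x y : Fin k × Fin k → Bool) (p : Fin k × Fin k) (hx : x p = true)
    (hy : y p = true) (q : Role k m → Role k m)
    (hq : ∀ s, q (q s) = s) (hne : ∀ s, q s ≠ s)
    (hst : ∀ s t, s ≠ t → rank x y s t < rank x y s (q s) → ¬ rank x y t s < rank x y t (q t)) :
    False := by
  have hp : ∀ g : Fin k ⊕ Fin k, q (.inl (g, 0)) = .inl (g, 1) := fun g => by
    rw [← partner_active x y q hq hne hst g, hq]
  refine hst (.inl (.inl p.1, 0)) (.inl (.inr p.2, 0)) (by simp) ?_ ?_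
  · rw [hp]; simp [rank, attracted, hx]
  · rw [hp]; simp [rank, attracted, hy]

end Gadget

/-! ### From rank functions with ties to strict preference lists -/

section Transfer

variable {V : Type} [Fintype V] [DecidableEq V]

/-- A preference list that sorts the other agents by a given rank function. -/
lemma exists_prefList (a : V) (r : V → ℕ) : ∃ L : PrefList a, ∀ b c, b ≠ a → c ≠ a →
    r b < r c → L.list.idxOf b < L.list.idxOf c := by
  classical
  set l := ((Finset.univ.erase a).toList).mergeSort (fun b c => decide (r b ≤ r c)) with hl
  have hmem : ∀ b, b ∈ l ↔ b ≠ a := fun b => by simp [hl]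
  have hperm := List.mergeSort_perm ((Finset.univ.erase a).toList) (fun b c => decide (r b ≤ r c))
  have hnd : l.Nodup := hperm.nodup_iff.2 (Finset.nodup_toList _)
  have hsort : l.Pairwise (fun b c => decide (r b ≤ r c) = true) :=
    List.pairwise_mergeSort (fun a b c => by simpa using le_trans)
      (fun a b => by simpa using le_total _ _) _
  refine ⟨⟨l, hnd, hmem⟩, fun b c hb hc hbc => ?_⟩
  have hb' : l.idxOf b < l.length := List.idxOf_lt_length_iff.2 ((hmem b).2 hb)
  have hc' : l.idxOf c < l.length := List.idxOf_lt_length_iff.2 ((hmem c).2 hc)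
  by_contra! hcon
  rcases hcon.lt_or_eq with h | h
  · have := List.pairwise_iff_getElem.1 hsort _ _ hc' hb' h
    simp at this
    omega
  · have : c = b := (List.idxOf_inj ((hmem c).2 hc)).1 h
    subst this; omega

/-- A preference list sorted by a rank function. -/
noncomputable def prefOfRank (a : V) (r : V → ℕ) : PrefList a := (exists_prefList a r).choose

lemma prefOfRank_lt (a : V) (r : V → ℕ) {b c : V} (hb : b ≠ a) (hc : c ≠ a) (h : r b < r c) :
    (prefOfRank a r).list.idxOf b < (prefOfRank a r).list.idxOf c :=
  (exists_prefList a r).choose_spec b c hb hc h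

variable {k m : ℕ}

/-- The instance for a pair of bit vectors, with agents in the given roles. -/
noncomputable def gadgetInstance (τ : V ≃ Role k m) (x y : Fin k × Fin k → Bool) : Instance V :=
  fun a => prefOfRank a fun b => rank x y (τ a) (τ b)

/-- Ties in `rank` are broken arbitrarily, which is harmless: the canonical matching has no blocking
pair even in the weak sense, and the obstruction to stability uses only strict rank inequalities. -/
theorem solvable_gadgetInstance_iff (τ : V ≃ Role k m) (x y : Fin k × Fin k → Bool) :
    Solvable (gadgetInstance τ x y) ↔ ∀ p, ¬ (x p = true ∧ y p = true) := by
  constructor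
  · rintro ⟨M, hM⟩ p ⟨hx, hy⟩
    refine exists_blocked x y p hx hy (fun s => τ (M.partner (τ.symm s)))
      (fun s => by simp [M.partner_partner]) (fun s h => ?_) (fun s t hne h1 h2 => ?_)
    · exact M.partner_ne (τ.symm s) (by rw [Equiv.eq_symm_apply]; exact h)
    · have hne' : τ.symm s ≠ τ.symm t := fun h => hne (τ.symm.injective h)
      refine hM (τ.symm s) (τ.symm t) ⟨hne', ?_, ?_, ?_⟩
      · intro h; simp [h] at h1
      · exact prefOfRank_lt _ _ hne'.symm (M.partner_ne _) (by simpa using h1)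
      · exact prefOfRank_lt _ _ hne' (M.partner_ne _) (by simpa using h2)
  · intro hxy
    refine ⟨⟨fun a => τ.symm (mate (τ a)), fun a h => ?_, fun a => by simp [mate_mate]⟩, ?_⟩
    · rw [Equiv.symm_apply_eq] at h
      exact mate_ne _ h
    · rintro a b ⟨hne, hab, h1, h2⟩
      have hab' : mate (τ a) ≠ τ b := fun h => hab (by
        change τ.symm (mate (τ a)) = b; rw [h]; simp)
      have hma : ∀ a : V, τ.symm (mate (τ a)) ≠ a := fun a h => by
        rw [Equiv.symm_apply_eq] at h
        exact mate_ne _ h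
      refine mate_not_blocked x y hxy (τ a) (τ b) hab' ?_ ?_
      · by_contra! hc
        exact absurd h1 (prefOfRank_lt a _ (hma a) hne.symm (by simpa using hc)).not_gt
      · by_contra! hc
        exact absurd h2 (prefOfRank_lt b _ (hma b) hne (by simpa using hc)).not_gt

/-- Only the active column agents depend on the second vector. -/
lemma rank_congr_right (x y y' : Fin k × Fin k → Bool) (s t : Role k m)
    (hs : ∀ j, s ≠ .inl (.inr j, 0)) : rank x y s t = rank x y' s t := by
  rcases s with ⟨i | j, c⟩ | ⟨d, b⟩ <;> rcases t with ⟨i' | j', c'⟩ | ⟨d', b'⟩ <;>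
    try fin_cases c
  all_goals try fin_cases c'
  all_goals first | rfl | (exfalso; exact hs _ rfl)

/-- Only the active row agents depend on the first vector. -/
lemma rank_congr_left (x x' y : Fin k × Fin k → Bool) (s t : Role k m)
    (hs : ∀ i, s ≠ .inl (.inl i, 0)) : rank x y s t = rank x' y s t := by
  rcases s with ⟨i | j, c⟩ | ⟨d, b⟩ <;> rcases t with ⟨i' | j', c'⟩ | ⟨d', b'⟩ <;>
    try fin_cases c
  all_goals try fin_cases c'
  all_goals first | rfl | (exfalso; exact hs _ rfl)

lemma gadgetInstance_congr_right (τ : V ≃ Role k m) (x y y' : Fin k × Fin k → Bool) (a : V)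
    (ha : ∀ j, τ a ≠ .inl (.inr j, 0)) : gadgetInstance τ x y a = gadgetInstance τ x y' a := by
  unfold gadgetInstance
  congr 1; ext b
  exact rank_congr_right x y y' _ _ ha

lemma gadgetInstance_congr_left (τ : V ≃ Role k m) (x x' y : Fin k × Fin k → Bool) (a : V)
    (ha : ∀ i, τ a ≠ .inl (.inl i, 0)) : gadgetInstance τ x y a = gadgetInstance τ x' y a := by
  unfold gadgetInstance
  congr 1; ext b
  exact rank_congr_left x x' y _ _ ha

end Transfer

/-! ### Two balanced sides and the placement of the active agents -/

section Partition

/-- Batches of at most half of the agents can be grouped into two sides of at least a quarter of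
the agents each. -/
lemma exists_balanced_union {V : Type} [Fintype V] [DecidableEq V]
    (P : Finpartition (Finset.univ : Finset V))
    (hP : ∀ S ∈ P.parts, 2 * S.card ≤ Fintype.card V) :
    ∃ S : Finset V, Fintype.card V ≤ 4 * S.card ∧ 4 * S.card ≤ 3 * Fintype.card V ∧
      ∀ Q ∈ P.parts, Q ⊆ S ∨ Disjoint Q S := by
  set n := Fintype.card V
  let F := P.parts.powerset.filter fun 𝒮 => 4 * (𝒮.biUnion id).card ≤ 3 * n
  have hF : F.Nonempty := ⟨∅, by simp [F]⟩
  obtain ⟨𝒮, hmem, hmax⟩ := F.exists_max_image (fun 𝒮 => (𝒮.biUnion id).card) hF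
  obtain ⟨hsub, hle⟩ := Finset.mem_filter.1 hmem
  rw [Finset.mem_powerset] at hsub
  have hdis : ∀ Q ∈ P.parts, Q ∉ 𝒮 → Disjoint Q (𝒮.biUnion id) := by
    intro Q hQ hQ'
    rw [Finset.disjoint_biUnion_right]
    intro Q' hQ''
    exact P.disjoint hQ (hsub hQ'') fun h => hQ' (h ▸ hQ'')
  refine ⟨𝒮.biUnion id, ?_, hle, fun Q hQ => ?_⟩
  -- A maximal union of size at most `3n / 4` cannot be below `n / 4`: one more batch adds at most
  -- `n / 2` agents and keeps it admissible.
  · by_contra! hlt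
    obtain ⟨a, ha⟩ : ∃ a, a ∉ 𝒮.biUnion id := by
      by_contra! hall
      have : 𝒮.biUnion id = Finset.univ := Finset.eq_univ_iff_forall.2 hall
      rw [this, Finset.card_univ] at hlt
      omega
    obtain ⟨Q, hQ, haQ⟩ := P.exists_mem (Finset.mem_univ a)
    have hQ𝒮 : Q ∉ 𝒮 := fun h => ha (Finset.mem_biUnion.2 ⟨Q, h, haQ⟩)
    have hcard : ((insert Q 𝒮).biUnion id).card = Q.card + (𝒮.biUnion id).card := by
      rw [Finset.biUnion_insert]
      exact Finset.card_union_of_disjoint (hdis Q hQ hQ𝒮)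
    have hpos : 0 < Q.card := Finset.card_pos.2 ⟨a, haQ⟩
    have hQn := hP Q hQ
    have := hmax (insert Q 𝒮) (Finset.mem_filter.2 ⟨Finset.mem_powerset.2
      (Finset.insert_subset hQ hsub), by omega⟩)
    omega
  · by_cases h : Q ∈ 𝒮
    · exact .inl (Finset.subset_biUnion_of_mem id h)
    · exact .inr (hdis Q hQ h)

/-- The roles can be assigned so that the row agents are in `S` and the column agents are not. -/
lemma exists_role_equiv {V : Type} [Fintype V] [DecidableEq V] {k m : ℕ}
    (hcard : Fintype.card V = 8 * k + 2 * m) (S : Finset V) (h1 : k ≤ S.card)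
    (h2 : k + S.card ≤ Fintype.card V) :
    ∃ τ : V ≃ Role k m, (∀ i, τ.symm (.inl (.inl i, 0)) ∈ S) ∧
      ∀ j, τ.symm (.inl (.inr j, 0)) ∉ S := by
  have hk1 : Fintype.card (Fin k) ≤ Fintype.card {a // a ∈ S} := by simpa using h1
  have hk2 : Fintype.card (Fin k) ≤ Fintype.card {a // a ∈ Sᶜ} := by
    rw [Fintype.card_coe, Finset.card_compl, Fintype.card_fin]
    omega
  obtain ⟨f⟩ := Function.Embedding.nonempty_of_card_le hk1
  obtain ⟨g⟩ := Function.Embedding.nonempty_of_card_le hk2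
  have hcard' : Fintype.card V = Fintype.card (Role k m) := by
    simp [hcard]; ring
  let F : Role k m → V := fun s => match s with
    | .inl (.inl i, _) => f i
    | .inl (.inr j, _) => g j
    | .inr d => (Fintype.equivOfCardEq hcard').symm (.inr d)
  -- Only the active roles are prescribed; the values of `F` elsewhere are irrelevant, and the
  -- injection extends to a bijection by equality of cardinalities.
  have hinj : Set.InjOn F {s | ∃ c, s = .inl (c, 0)} := by
    rintro _ ⟨i | j, rfl⟩ _ ⟨i' | j', rfl⟩ h
    · simpa [F, ← Subtype.ext_iff] using h
    · have h3 := (g j').2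
      rw [Finset.mem_compl] at h3
      exact absurd ((show (f i : V) = g j' from h) ▸ (f i).2) h3
    · have h3 := (g j).2
      rw [Finset.mem_compl] at h3
      exact absurd ((show (g j : V) = f i' from h) ▸ (f i').2) h3
    · simpa [F, ← Subtype.ext_iff] using h
  obtain ⟨e, he⟩ := Set.MapsTo.exists_equiv_extend_of_card_eq (t := (Finset.univ : Finset V))
    (by rw [Finset.card_univ, hcard']) (f := F) (fun _ _ => by simp) hinj
  refine ⟨(e.trans (Equiv.subtypeUnivEquiv fun _ => Finset.mem_univ _)).symm,
    fun i => ?_, fun j => ?_⟩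
  · have := he (.inl (.inl i, 0)) ⟨_, rfl⟩
    simp [Equiv.subtypeUnivEquiv, this, F]
  · have := he (.inl (.inr j, 0)) ⟨_, rfl⟩
    simp only [Equiv.symm_symm, Equiv.trans_apply, Equiv.subtypeUnivEquiv_apply, this, F]
    exact Finset.mem_compl.1 (g j).2

end Partition

end StableRoommates

namespace StableRoommates

open scoped BigOperators

/-! ### Linearity and bounds for the two distributions -/

section Means

variable {ι : Type*} [Fintype ι] [DecidableEq ι]

lemma disjMean_add (h h' : (ι → Bool) → (ι → Bool) → ℝ) :
    disjMean (fun x y => h x y + h' x y) = disjMean h + disjMean h' := by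
  simp only [disjMean, Finset.expect_add_distrib]

lemma meetMean_add (h h' : (ι → Bool) → (ι → Bool) → ℝ) :
    meetMean (fun x y => h x y + h' x y) = meetMean h + meetMean h' := by
  simp only [meetMean, Finset.expect_add_distrib]

lemma disjMean_zero : disjMean (fun _ _ : ι → Bool => (0 : ℝ)) = 0 := by
  simp [disjMean]

lemma meetMean_zero : meetMean (fun _ _ : ι → Bool => (0 : ℝ)) = 0 := by
  simp [meetMean]

lemma le_disjMean {b : ℝ} (h : (ι → Bool) → (ι → Bool) → ℝ)
    (hb : ∀ x y, (∀ i, ¬ (x i = true ∧ y i = true)) → b ≤ h x y) : b ≤ disjMean h := by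
  refine Finset.le_expect Finset.univ_nonempty fun z _ =>
    Finset.le_expect Finset.univ_nonempty fun x _ =>
    Finset.le_expect Finset.univ_nonempty fun y _ => hb _ _ fun i => ?_
  simp only [mask, compl]
  cases z i <;> simp

lemma meetMean_le [Nonempty ι] {b : ℝ} (h : (ι → Bool) → (ι → Bool) → ℝ)
    (hb : ∀ x y i, x i = true → y i = true → h x y ≤ b) : meetMean h ≤ b := by
  refine Finset.expect_le Finset.univ_nonempty fun i _ =>
    Finset.expect_le Finset.univ_nonempty fun z _ =>
    Finset.expect_le Finset.univ_nonempty fun x _ =>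
    Finset.expect_le Finset.univ_nonempty fun y _ => hb _ _ i ?_ ?_ <;> simp

lemma hasSum_expect {α T : Type*} [Fintype α] {F : α → T → ℝ} {G : α → ℝ}
    (h : ∀ a, HasSum (F a) (G a)) : HasSum (fun t => 𝔼 a, F a t) (𝔼 a, G a) := by
  simp_rw [Fintype.expect_eq_sum_div_card]
  exact (hasSum_sum fun a _ => h a).div_const _

lemma hasSum_disjMean {T : Type*} {F : T → (ι → Bool) → (ι → Bool) → ℝ}
    {G : (ι → Bool) → (ι → Bool) → ℝ} (h : ∀ x y, HasSum (fun t => F t x y) (G x y)) :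
    HasSum (fun t => disjMean (F t)) (disjMean G) :=
  hasSum_expect fun _ => hasSum_expect fun _ => hasSum_expect fun _ => h _ _

lemma hasSum_meetMean {T : Type*} {F : T → (ι → Bool) → (ι → Bool) → ℝ}
    {G : (ι → Bool) → (ι → Bool) → ℝ} (h : ∀ x y, HasSum (fun t => F t x y) (G x y)) :
    HasSum (fun t => meetMean (F t)) (meetMean G) :=
  hasSum_expect fun _ => hasSum_expect fun _ => hasSum_expect fun _ => hasSum_expect fun _ => h _ _

lemma disjMean_const_mul (c : ℝ) (h : (ι → Bool) → (ι → Bool) → ℝ) :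
    disjMean (fun x y => c * h x y) = c * disjMean h := by
  simp only [disjMean, Finset.mul_expect]

lemma meetMean_const_mul (c : ℝ) (h : (ι → Bool) → (ι → Bool) → ℝ) :
    meetMean (fun x y => c * h x y) = c * meetMean h := by
  simp only [meetMean, Finset.mul_expect]

end Means

/-! ### Procedures as unions of rectangles, and their acceptance probabilities -/

section Procedures

variable {V : Type} [Fintype V] [DecidableEq V] {P : Finpartition (Finset.univ : Finset V)}

/-- The indicator that a procedure accepts an instance after at most `q` queries. -/
def accepts (t : Procedure P) (q : ℕ) (R : Instance V) : ℝ :=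
  if t.run R = true ∧ t.numQueries R ≤ q then 1 else 0

lemma accepts_query_succ (Q : BatchQuery P) (next : Bool → Procedure P) (q : ℕ)
    (R : Instance V) :
    accepts (.query Q next) (q + 1) R = accepts (next (Q.answer R)) q R := by
  simp [accepts, Procedure.run, Procedure.numQueries]

lemma accepts_query_zero (Q : BatchQuery P) (next : Bool → Procedure P) (R : Instance V) :
    accepts (.query Q next) 0 R = 0 := by
  simp [accepts, Procedure.run, Procedure.numQueries]

lemma accepts_output (b : Bool) (q : ℕ) (R : Instance V) :
    accepts (.output b : Procedure P) q R = if b then 1 else 0 := by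
  simp [accepts, Procedure.run, Procedure.numQueries]

/-- A corruption bound for rectangles extends to procedures each of whose queries depends on one
of the two vectors only, with a loss that is exponential in the number of queries. -/
lemma corruption_procedure {ι : Type} [Fintype ι] [DecidableEq ι]
    (inst : (ι → Bool) → (ι → Bool) → Instance V)
    (hside : ∀ Q : BatchQuery P, (∃ φ : (ι → Bool) → Bool, ∀ x y, Q.answer (inst x y) = φ x) ∨
      ∃ φ : (ι → Bool) → Bool, ∀ x y, Q.answer (inst x y) = φ y)
    {a e : ℝ} (he : 0 ≤ e)
    (hC : ∀ f g : (ι → Bool) → ℝ, (∀ x, 0 ≤ f x) → (∀ x, f x ≤ 1) → (∀ x, 0 ≤ g x) →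
      (∀ x, g x ≤ 1) →
      a * disjMean (fun x y => f x * g y) - e ≤ meetMean (fun x y => f x * g y))
    (t : Procedure P) : ∀ (q : ℕ) (f g : (ι → Bool) → ℝ),
      (∀ x, 0 ≤ f x) → (∀ x, f x ≤ 1) → (∀ x, 0 ≤ g x) → (∀ x, g x ≤ 1) →
      a * disjMean (fun x y => f x * g y * accepts t q (inst x y)) - 2 ^ q * e
        ≤ meetMean (fun x y => f x * g y * accepts t q (inst x y)) := by
  induction t with
  | output b =>
    intro q f g hf0 hf1 hg0 hg1
    have h2 : (1 : ℝ) ≤ 2 ^ q := one_le_pow₀ (by norm_num)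
    simp only [accepts_output]
    cases b
    · simp only [Bool.false_eq_true, if_false, mul_zero, disjMean_zero, meetMean_zero]
      nlinarith
    · simp only [if_true, mul_one]
      have := hC f g hf0 hf1 hg0 hg1
      nlinarith
  | query Q next ih =>
    intro q f g hf0 hf1 hg0 hg1
    cases q with
    | zero =>
      -- With the query budget exhausted nothing is accepted, so truncated branches cost nothing but
      -- the error term.
      simp only [accepts_query_zero, mul_zero, disjMean_zero, meetMean_zero]
      simpa using he
    | succ q =>
      simp only [accepts_query_succ]
      have h0 : ∀ (c : Prop) [Decidable c] (r : ℝ), 0 ≤ r → 0 ≤ if c then r else 0 :=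
        fun c _ r hr => by split_ifs <;> simp [hr]
      have h1 : ∀ (c : Prop) [Decidable c] (r : ℝ), r ≤ 1 → (if c then r else 0) ≤ 1 :=
        fun c _ r hr => by split_ifs <;> simp [hr]
      rcases hside Q with ⟨φ, hφ⟩ | ⟨φ, hφ⟩
      -- A query seen by one side cuts the rectangle in two along that side; each half is a
      -- rectangle with budget `q`, so the error doubles.
      · have hsplit : (fun x y => f x * g y * accepts (next (Q.answer (inst x y))) q (inst x y))
            = fun x y =>
              (if φ x = true then f x else 0) * g y * accepts (next true) q (inst x y)
              + (if φ x = false then f x else 0) * g y * accepts (next false) q (inst x y) := by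
          funext x y
          rw [hφ]
          cases φ x <;> simp
        rw [hsplit, disjMean_add, meetMean_add]
        have t1 := ih true q (fun x => if φ x = true then f x else 0) g
          (fun x => h0 _ _ (hf0 x)) (fun x => h1 _ _ (hf1 x)) hg0 hg1
        have t2 := ih false q (fun x => if φ x = false then f x else 0) g
          (fun x => h0 _ _ (hf0 x)) (fun x => h1 _ _ (hf1 x)) hg0 hg1
        rw [pow_succ]
        linarith
      · have hsplit : (fun x y => f x * g y * accepts (next (Q.answer (inst x y))) q (inst x y))
            = fun x y =>
              f x * (if φ y = true then g y else 0) * accepts (next true) q (inst x y)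
              + f x * (if φ y = false then g y else 0) * accepts (next false) q (inst x y) := by
          funext x y
          rw [hφ]
          cases φ y <;> simp
        rw [hsplit, disjMean_add, meetMean_add]
        have t1 := ih true q f (fun x => if φ x = true then g x else 0)
          hf0 hf1 (fun x => h0 _ _ (hg0 x)) (fun x => h1 _ _ (hg1 x))
        have t2 := ih false q f (fun x => if φ x = false then g x else 0)
          hf0 hf1 (fun x => h0 _ _ (hg0 x)) (fun x => h1 _ _ (hg1 x))
        rw [pow_succ]
        linarith

/-- The probability that a randomized procedure accepts an instance after at most `q` queries. -/
noncomputable def acceptProb (𝒜 : RandomizedProcedure P) (q : ℕ) (R : Instance V) : ℝ :=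
  (𝒜.toOuterMeasure {t | t.run R = true ∧ t.numQueries R ≤ q}).toReal

lemma hasSum_acceptProb (𝒜 : RandomizedProcedure P) (q : ℕ) (R : Instance V) :
    HasSum (fun t => (𝒜 t).toReal * accepts t q R) (acceptProb 𝒜 q R) := by
  classical
  unfold acceptProb
  have hle : ∀ s : Set (Procedure P), 𝒜.toOuterMeasure s ≤ 1 := fun s => by
    rw [PMF.toOuterMeasure_apply]
    exact (ENNReal.tsum_le_tsum fun t => Set.indicator_le_self _ _ _).trans 𝒜.tsum_coe.le
  have hne := ne_top_of_le_ne_top ENNReal.one_ne_top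
    (hle {t | t.run R = true ∧ t.numQueries R ≤ q})
  rw [PMF.toOuterMeasure_apply] at hne ⊢
  have := ENNReal.hasSum_toReal hne
  convert this using 1
  · funext t
    by_cases h : t.run R = true ∧ t.numQueries R ≤ q
    · simp [accepts, h]
    · simp [accepts, Set.indicator, h]
  · rw [ENNReal.tsum_toReal_eq]
    intro t
    exact ne_top_of_le_ne_top (𝒜.apply_ne_top t) (Set.indicator_le_self _ _ _)

/-- The corruption bound for randomized procedures. -/
lemma corruption_randomized {ι : Type} [Fintype ι] [DecidableEq ι]
    (inst : (ι → Bool) → (ι → Bool) → Instance V)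
    (hside : ∀ Q : BatchQuery P, (∃ φ : (ι → Bool) → Bool, ∀ x y, Q.answer (inst x y) = φ x) ∨
      ∃ φ : (ι → Bool) → Bool, ∀ x y, Q.answer (inst x y) = φ y)
    {a e : ℝ} (he : 0 ≤ e)
    (hC : ∀ f g : (ι → Bool) → ℝ, (∀ x, 0 ≤ f x) → (∀ x, f x ≤ 1) → (∀ x, 0 ≤ g x) →
      (∀ x, g x ≤ 1) →
      a * disjMean (fun x y => f x * g y) - e ≤ meetMean (fun x y => f x * g y))
    (𝒜 : RandomizedProcedure P) (q : ℕ) :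
    a * disjMean (fun x y => acceptProb 𝒜 q (inst x y)) - 2 ^ q * e
      ≤ meetMean (fun x y => acceptProb 𝒜 q (inst x y)) := by
  have hd := hasSum_disjMean fun x y => hasSum_acceptProb 𝒜 q (inst x y)
  have hm := hasSum_meetMean fun x y => hasSum_acceptProb 𝒜 q (inst x y)
  simp only [disjMean_const_mul, meetMean_const_mul] at hd hm
  have h1 : HasSum (fun t => (𝒜 t).toReal) 1 := by
    have h : ∑' t, 𝒜 t ≠ ∞ := by rw [𝒜.tsum_coe]; exact ENNReal.one_ne_top
    have := ENNReal.hasSum_toReal h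
    rwa [← ENNReal.tsum_toReal_eq 𝒜.apply_ne_top, 𝒜.tsum_coe, ENNReal.toReal_one] at this
  have hl := (hd.mul_left a).sub (h1.mul_right (2 ^ q * e))
  rw [one_mul] at hl
  refine hasSum_le (fun t => ?_) hl hm
  have := corruption_procedure inst hside he hC t q (fun _ => 1) (fun _ => 1)
    (fun _ => zero_le_one) (fun _ => le_rfl) (fun _ => zero_le_one) (fun _ => le_rfl)
  simp only [one_mul] at this
  have := mul_le_mul_of_nonneg_left this (ENNReal.toReal_nonneg (a := 𝒜 t))
  linarith

/-- Truncating at `q` queries can only lower the probability of acceptance. -/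
lemma acceptProb_le {𝒜 : RandomizedProcedure P} {ε : ℝ≥0} (h𝒜 : 𝒜.DecidesSolvability ε)
    (q : ℕ) {R : Instance V} (hR : ¬ Solvable R) : acceptProb 𝒜 q R ≤ ε := by
  have : 𝒜.toOuterMeasure {t | t.run R = true ∧ t.numQueries R ≤ q} ≤ ε :=
    (MeasureTheory.measure_mono fun t ht => fun h => hR (h.1 ht.1)).trans (h𝒜 R)
  simpa [acceptProb] using ENNReal.toReal_mono ENNReal.coe_ne_top this

lemma markov_numQueries (𝒜 : RandomizedProcedure P) (q : ℕ) (R : Instance V) :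
    ((q + 1 : ℕ) : ℝ≥0∞) * 𝒜.toOuterMeasure {t | q < t.numQueries R} ≤ 𝒜.expectedQueries R := by
  classical
  rw [PMF.toOuterMeasure_apply, ← ENNReal.tsum_mul_left, RandomizedProcedure.expectedQueries]
  refine ENNReal.tsum_le_tsum fun t => ?_
  by_cases h : q < t.numQueries R
  · rw [Set.indicator_of_mem (by exact h), mul_comm]
    gcongr
    exact h
  · rw [Set.indicator_of_notMem (by exact h)]
    simp

/-- On a solvable instance, acceptance within `q` queries fails only through a wrong output (at most
`ε`) or through a long run (at most `γ`, by Markov). -/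
lemma le_acceptProb {𝒜 : RandomizedProcedure P} {ε : ℝ≥0} (h𝒜 : 𝒜.DecidesSolvability ε)
    (q : ℕ) {γ : ℝ≥0} {R : Instance V} (hR : Solvable R)
    (hE : 𝒜.expectedQueries R ≤ ((q + 1 : ℕ) : ℝ≥0∞) * γ) : 1 - ε - γ ≤ acceptProb 𝒜 q R := by
  set p := 𝒜.toOuterMeasure {t | t.run R = true ∧ t.numQueries R ≤ q} with hp
  have hM : 𝒜.toOuterMeasure {t | q < t.numQueries R} ≤ γ :=
    (ENNReal.mul_le_mul_iff_right (by simp) (ENNReal.natCast_ne_top _)).1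
      ((markov_numQueries 𝒜 q R).trans hE)
  have hcov : (1 : ℝ≥0∞) ≤ p + ε + γ := by
    calc (1 : ℝ≥0∞) = 𝒜.toOuterMeasure Set.univ := by
          rw [PMF.toOuterMeasure_apply, Set.indicator_univ, 𝒜.tsum_coe]
      _ ≤ 𝒜.toOuterMeasure ({t | t.run R = true ∧ t.numQueries R ≤ q}
            ∪ {t | ¬ (t.run R = true ↔ Solvable R)} ∪ {t | q < t.numQueries R}) := by
          refine MeasureTheory.measure_mono fun t _ => ?_
          by_cases h1 : q < t.numQueries R
          · exact .inr h1
          · by_cases h2 : t.run R = true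
            · exact .inl (.inl ⟨h2, not_lt.1 h1⟩)
            · exact .inl (.inr fun h => h2 (h.2 hR))
      _ ≤ p + 𝒜.toOuterMeasure {t | ¬ (t.run R = true ↔ Solvable R)}
            + 𝒜.toOuterMeasure {t | q < t.numQueries R} :=
          (MeasureTheory.measure_union_le _ _).trans (by gcongr; exact MeasureTheory.measure_union_le _ _)
      _ ≤ p + ε + γ := by gcongr; exact h𝒜 R
  have hpt : p ≠ ∞ := by
    refine ne_top_of_le_ne_top ENNReal.one_ne_top ?_
    rw [hp, PMF.toOuterMeasure_apply]
    exact (ENNReal.tsum_le_tsum fun t => Set.indicator_le_self _ _ _).trans 𝒜.tsum_coe.le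
  have := ENNReal.toReal_mono (by simp [hpt]) hcov
  rw [ENNReal.toReal_add (by simp [hpt]) (by simp), ENNReal.toReal_add hpt (by simp)] at this
  simp only [ENNReal.toReal_one, ENNReal.coe_toReal] at this
  change _ ≤ p.toReal
  linarith

/-- A query to a batch on one side depends on one of the two vectors only. -/
lemma answer_gadgetInstance {k m : ℕ} (τ : V ≃ Role k m) (S : Finset V)
    (hS : ∀ Q ∈ P.parts, Q ⊆ S ∨ Disjoint Q S) (hl : ∀ i, τ.symm (.inl (.inl i, 0)) ∈ S)
    (hr : ∀ j, τ.symm (.inl (.inr j, 0)) ∉ S) (Q : BatchQuery P) :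
    (∃ φ : (Fin k × Fin k → Bool) → Bool, ∀ x y, Q.answer (gadgetInstance τ x y) = φ x) ∨
      ∃ φ : (Fin k × Fin k → Bool) → Bool, ∀ x y, Q.answer (gadgetInstance τ x y) = φ y := by
  rcases hS _ Q.batch_mem with h | h
  -- All active column agents lie outside the batch, so any fixed vector can stand in for `y`.
  · refine .inl ⟨fun x => Q.answer (gadgetInstance τ x fun _ => false), fun x y => ?_⟩
    unfold BatchQuery.answer
    congr 1
    funext a
    refine gadgetInstance_congr_right τ x y _ a.1 fun j hj => hr j ?_
    rw [← hj, Equiv.symm_apply_apply]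
    exact h a.2
  · refine .inr ⟨fun y => Q.answer (gadgetInstance τ (fun _ => false) y), fun x y => ?_⟩
    unfold BatchQuery.answer
    congr 1
    funext a
    refine gadgetInstance_congr_left τ x _ y a.1 fun i hi => ?_
    refine Finset.disjoint_left.1 h a.2 ?_
    rw [← Equiv.symm_apply_apply τ a.1, hi]
    exact hl i

end Procedures

end StableRoommates

/-! ### Choice of constants and conclusion -/

open StableRoommates

theorem theorem3 (ε : ℝ≥0) (hε : ε < 1 / 2) :
    ∃ c : ℝ≥0, 0 < c ∧ ∃ n₀ : ℕ, ∀ n : ℕ, n₀ ≤ n → Even n →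
      ∀ P : Finpartition (Finset.univ : Finset (Fin n)),
        (∀ S ∈ P.parts, (S.card : ℝ) ≤ (n : ℝ) / 2) →
        ∀ 𝒜 : StableRoommates.RandomizedProcedure P,
          StableRoommates.RandomizedProcedure.DecidesSolvability 𝒜 ε →
          ∃ R : StableRoommates.Instance (Fin n),
            (c : ℝ≥0∞) * (n : ℝ≥0∞) ^ 2 ≤
              StableRoommates.RandomizedProcedure.expectedQueries 𝒜 R := by
  have hε' : (ε : ℝ) < 1 / 2 := by exact_mod_cast hε
  have hε0 : (0 : ℝ) ≤ ε := ε.2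
  obtain ⟨γ, hγdef⟩ : ∃ γ : ℝ≥0, (γ : ℝ) = (1 - 2 * ε) / 8 :=
    ⟨⟨(1 - 2 * ε) / 8, by linarith⟩, rfl⟩
  have hγ : (0 : ℝ) < γ := by rw [hγdef]; linarith
  obtain ⟨δ, hδ, -, hcor⟩ := corruption_bound hγ (by linarith)
  -- Here 512 is 256, from `n ≤ 16 * k`, times 2, from the budget of about `δ * k ^ 2 / 2` queries.
  -- The threshold on `n` makes `δ * k ^ 2 / 2 ≥ 1 / γ`, so that the total error of `2 ^ q`
  -- rectangles is at most `γ`.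
  refine ⟨γ * δ.toNNReal / 512, ?_, ⌈32 / (δ * γ)⌉₊ + 8, ?_⟩
  · have : 0 < δ.toNNReal := Real.toNNReal_pos.2 hδ
    have : 0 < γ := by exact_mod_cast hγ
    positivity
  intro n hn hev P hP 𝒜 h𝒜
  by_contra! hcon
  set k := n / 8 with hk
  obtain ⟨r, hr⟩ := hev
  have hcard : Fintype.card (Fin n) = 8 * k + 2 * ((n - 8 * k) / 2) := by
    rw [Fintype.card_fin]; omega
  have hk1 : 1 ≤ k := by omega
  obtain ⟨S, hS1, hS2, hS⟩ := exists_balanced_union P fun S hS => by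
    have := hP S hS
    rw [Fintype.card_fin]
    have h2 : (2 * S.card : ℝ) ≤ n := by linarith
    exact_mod_cast h2
  rw [Fintype.card_fin] at hS1 hS2
  obtain ⟨τ, hl, hr'⟩ := exists_role_equiv hcard S (by omega) (by rw [Fintype.card_fin]; omega)
  have : Nonempty (Fin k × Fin k) := ⟨(⟨0, hk1⟩, ⟨0, hk1⟩)⟩
  set N : ℝ := (k : ℝ) ^ 2 with hN
  have hk1' : (1 : ℝ) ≤ k := by exact_mod_cast hk1
  have hn16 : (n : ℝ) ≤ 16 * k := by
    have : n ≤ 16 * k := by omega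
    exact_mod_cast this
  have hn2 : (n : ℝ) ^ 2 ≤ 256 * N := by
    rw [hN]; nlinarith [Nat.cast_nonneg (α := ℝ) n]
  have hNbig : 1 / γ ≤ δ * N / 2 := by
    have h1 : 32 / (δ * γ) ≤ n := by
      refine (Nat.le_ceil _).trans ?_
      have : ⌈32 / (δ * γ)⌉₊ ≤ n := by omega
      exact_mod_cast this
    have h2 : 32 / (δ * γ) ≤ 16 * N := h1.trans (by rw [hN]; nlinarith)
    rw [div_le_iff₀ (by positivity)] at h2 ⊢
    nlinarith
  -- Half of the exponent goes to the number of rectangles, as `2 ^ q ≤ exp (δ * N / 2)`; the other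
  -- half remains as decay.
  set q := ⌊δ * N / 2⌋₊ with hq
  have hq1 : (q : ℝ) ≤ δ * N / 2 := Nat.floor_le (by positivity)
  have hq2 : δ * N / 2 ≤ (q : ℝ) + 1 := (Nat.lt_floor_add_one _).le
  have herr : 2 ^ q * Real.exp (-(δ * N)) ≤ γ := by
    have h2 : (2 : ℝ) ^ q ≤ Real.exp (δ * N / 2) := by
      have h21 : (2 : ℝ) ≤ Real.exp 1 := by have := Real.add_one_le_exp 1; linarith
      calc (2 : ℝ) ^ q ≤ Real.exp 1 ^ q := pow_le_pow_left₀ (by norm_num) h21 q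
        _ = Real.exp q := by rw [← Real.exp_nat_mul, mul_one]
        _ ≤ _ := Real.exp_le_exp.2 hq1
    calc 2 ^ q * Real.exp (-(δ * N)) ≤ Real.exp (δ * N / 2) * Real.exp (-(δ * N)) := by gcongr
      _ = (Real.exp (δ * N / 2))⁻¹ := by
          rw [← Real.exp_add, ← Real.exp_neg]; congr 1; ring
      _ ≤ (1 / (γ : ℝ))⁻¹ := by
          gcongr
          have := Real.add_one_le_exp (δ * N / 2)
          linarith
      _ = γ := by simp
  have hE : ∀ R, 𝒜.expectedQueries R ≤ ((q + 1 : ℕ) : ℝ≥0∞) * γ := by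
    intro R
    refine (hcon R).le.trans ?_
    have hreal : (γ * δ.toNNReal / 512) * (n : ℝ≥0) ^ 2 ≤ ((q + 1 : ℕ) : ℝ≥0) * γ := by
      rw [← NNReal.coe_le_coe]
      push_cast
      rw [Real.coe_toNNReal δ hδ.le]
      have h1 : γ * δ / 512 * (n : ℝ) ^ 2 ≤ γ * δ / 512 * (256 * N) := by gcongr
      nlinarith
    exact_mod_cast hreal
  have hmain := corruption_randomized (gadgetInstance τ)
    (answer_gadgetInstance τ S hS hl hr') (Real.exp_pos (-(δ * N))).le
    (fun f g h1 h2 h3 h4 => by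
      have := hcor (Fin k × Fin k) f g h1 h2 h3 h4
      rw [Fintype.card_prod, Fintype.card_fin, Nat.cast_mul, ← pow_two, ← hN] at this
      exact this) 𝒜 q
  have hlow : 1 - (ε : ℝ) - γ ≤ disjMean fun x y => acceptProb 𝒜 q (gadgetInstance τ x y) :=
    le_disjMean _ fun x y hxy =>
      le_acceptProb h𝒜 q ((solvable_gadgetInstance_iff τ x y).2 hxy) (hE _)
  have hup : (meetMean fun x y => acceptProb 𝒜 q (gadgetInstance τ x y)) ≤ ε :=
    meetMean_le _ fun x y p hx hy =>
      acceptProb_le h𝒜 q fun h => (solvable_gadgetInstance_iff τ x y).1 h p ⟨hx, hy⟩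
  have hγ1 : (γ : ℝ) ≤ 1 := by linarith
  -- The bounds combine to `(1 - γ) * (1 - ε - γ) - γ ≤ ε`, which forces `1 - 2 * ε ≤ 3 * γ`,
  -- contrary to `8 * γ = 1 - 2 * ε` with `γ > 0`.
  have h5 := mul_le_mul_of_nonneg_left hlow (sub_nonneg.2 hγ1)
  nlinarith
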